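/- **Setting.** Let $\mathcal S$ be a countable set of states, $\mathcal A$ a finite non-empty set of actions of Controller, $\mathcal A_2\subseteq\mathbb R^p$ with $0\in\mathcal A_2$ the set of actions of Shaper ($0$ is the null action), $P(\cdot\,;a,s)$ a probability distribution on $\mathcal S$ for each $(s,a)$, and $\gamma\in(0,1)$. Let $R:\mathcal S\times\mathcal A\to\mathbb R$, $\phi:\mathcal S\times\mathcal A_2\to\mathbb R$ and $L:\mathcal S\times\mathbb N\to\mathbb R$ be bounded, with $\phi(s,\cdot)$ continuous and $\phi(s,0)=0$ for all $s$, and let $c:\{0,1\}^2\to(-\infty,0)$. A Controller policy is a Markov policy $\pi(\cdot|s)\in\Delta(\mathcal A)$. A Shaper policy is a pair $\rho=(\mathfrak g_2,\pi^2)$ with $\mathfrak g_2:\mathcal S\to\{0,1\}$ and $\pi^2(\cdot|s)$ a discrete probability distribution on $\mathcal A_2$ (switching controls). From $(s_0,I_0)\in\mathcal S\times\{0,1\}$ the game $\mathcal G$ is played as follows, for $t=0,1,\dots$: $a_t\sim\pi(\cdot|s_t)$; if $\mathfrak g_2(s_t)=1$ then Shaper flips the switch, $I_{t+1}=1-I_t$,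 and otherwise $I_{t+1}=I_t$; $a^2_t\sim\pi^2(\cdot|s_t)$ if $I_t=1$ and $\mathfrak g_2(s_t)=0$, and $a^2_t=0$ otherwise (so $a^2_t=0$ at switching times); $s_{t+1}\sim P(\cdot\,;a_t,s_t)$. Put $$\hat F_t=\phi(s_t,a^2_t)-\gamma^{-1}\phi(s_{t-1},a^2_{t-1}),\qquad \hat R_{1,t}=R(s_t,a_t)+\hat F_t I_t,$$ where the second term of $\hat F_0$ is absent, let $c_t=c(1,0)$ if shaping is activated at time $t$ (that is, $I_t=0$, $I_{t+1}=1$) and $c_t=0$ otherwise, and let $n_t$ be the number of visits to $s_t$ before time $t$. The objectives of Controller and Shaper are $$v_1^{\pi,\rho}(s_0,I_0)=\mathbb E\sum_{t\ge0}\gamma^t\hat R_{1,t},\qquad v_2^{\pi,\rho}(s_0,I_0)=\mathbb E\sum_{t\ge0}\gamma^t\bigl(\hat R_{1,t}+c_t+L(s_t,n_t)\bigr),$$ and the value of a profile (Shaper's return without the bonus $L$) is $V^{\pi,\rho}(s_0,I_0)=\mathbb E\sum_{t\ge0}\gamma^t(\hat R_{1,t}+c_t)$. A profile $(\pi,\rho)$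 is a stable point (Markov perfect equilibrium) if $v_1^{\pi,\rho}\ge v_1^{\pi',\rho}$ and $v_2^{\pi,\rho}\ge v_2^{\pi,\rho'}$ on $\mathcal S\times\{0,1\}$ for all Controller policies $\pi'$ and Shaper policies $\rho'$. For bounded $\Lambda:\mathcal S\times\{0,1\}\to\mathbb R$ and a Controller policy $\pi$, the intervention operator and the Bellman operator are $$\mathcal M^{\pi}\Lambda(s,I)=\sum_{a}\pi(a|s)\Bigl[\hat R_1(s,I,a,0,\cdot)+c(1-I,I)+\gamma\sum_{s'}P(s';a,s)\Lambda(s',1-I)\Bigr],$$ $$T\Lambda(s,I)=\max\Bigl\{\mathcal M^{\pi}\Lambda(s,I),\ \max_{a\in\mathcal A}\Bigl[R(s,a)+\gamma\sum_{s'}P(s';a,s)\Lambda(s',I)\Bigr]\Bigr\},$$ where $\hat R_1(s,I,a,0,\cdot)=R(s,a)+\phi(s,0)I$ is the shaped reward with null Shaper action at the switching time and no preceding Shaper action. **Theorem.** For every $\pi$, $T$ is a $\gamma$-contraction for the sup norm on bounded functions. There is a stable point $(\pi^\star,\rho^\star)$ of $\mathcal G$ in Markov policies, with Shaper using switching controls,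 such that for every choice of $\pi$ in $T$ and every bounded $V:\mathcal S\times\{0,1\}\to\mathbb R$, $$\lim_{k\to\infty}T^kV=V^{\pi^\star,\rho^\star}=\sup_{(\pi',\rho')}V^{\pi',\rho'},$$ the limit being uniform and the supremum, over all policy profiles, being attained pointwise. Moreover a profile $(\pi',\rho')$ is a stable point if and only if $V^{\pi',\rho'}=V^{\pi^\star,\rho^\star}$. -/

import Mathlib

open MeasureTheory ProbabilityTheory Filter Topology

noncomputable section

/-- The data of the reward-shaping game `𝒢` between Controller and Shaper.
The switch takes values in `{0, 1}`, encoded as `Bool`.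
* `P`, `R`, `γ`: transition probabilities (driven by Controller only), environment reward, discount;
* `A₂ ⊆ ℝᵖ`: Shaper's action set, with null action `0`;
* `φ`: the shaping potential; `c`: the strictly negative switching cost;
* `L s n`: Shaper's bonus for a visit to `s` after `n` earlier visits to `s`. -/
structure ShapingGame (S A : Type*) (p : ℕ) where
  A₂ : Set (EuclideanSpace ℝ (Fin p))
  zero_mem : 0 ∈ A₂
  P : S → A → PMF S
  R : S → A → ℝ
  φ : S → A₂ → ℝ
  c : Bool → Bool → ℝ
  L : S → ℕ → ℝ
  γ : ℝ
  γ_pos : 0 < γ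
  γ_lt_one : γ < 1
  φ_continuous : ∀ s, Continuous (φ s)
  φ_zero : ∀ s, φ s ⟨0, zero_mem⟩ = 0
  c_neg : ∀ i j, c i j < 0
  R_bounded : ∃ C, ∀ s a, |R s a| ≤ C
  φ_bounded : ∃ C, ∀ s b, |φ s b| ≤ C
  L_bounded : ∃ C, ∀ s n, |L s n| ≤ C

/-- What happens in one period `t`: the state `s_t`, the position `I_t` of the switch on arrival in
`s_t`, Controller's action `a_t` and Shaper's action `a²_t`. -/
structure ShapingStep (S A B : Type*) where
  state : S
  switch : Bool
  act : A
  shaperAct : B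

/-- All events concerning a single period are measurable (the law of each period is discrete). -/
instance ShapingStep.instMeasurableSpace (S A B : Type*) :
    MeasurableSpace (ShapingStep S A B) := ⊤

namespace ShapingGame

variable {S A : Type*} {p : ℕ} (G : ShapingGame S A p)

/-- A (stochastic) Markov policy of Controller. -/
abbrev ControllerPolicy (_G : ShapingGame S A p) : Type _ := S → PMF A

/-- A Markov policy of Shaper with switching controls: `flip s = true` means that Shaper switches
(from off to on, or from on to off) on visiting `s`; `mag` gives the law of Shaper's action. -/
structure ShaperPolicy where
  flip : S → Bool
  mag : S → PMF G.A₂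

/-- Shaper's null action. -/
def null : G.A₂ := ⟨0, G.zero_mem⟩

variable {G}

/-- The law of period `t` given `(s_t, I_t)`. Controller samples from its policy; Shaper samples
from `mag` if the switch is on and is left on, and otherwise its action is null (in particular it is
null at each switching time). -/
def stepLaw (π : G.ControllerPolicy) (ρ : G.ShaperPolicy) (s : S) (i : Bool) :
    PMF (ShapingStep S A G.A₂) :=
  (π s).bind fun a =>
    (if i = true ∧ ρ.flip s = false then ρ.mag s else PMF.pure G.null).map fun b => ⟨s, i, a, b⟩

/-- The law of the next period: `s_{t+1} ∼ P(·; s_t, a_t)`, and the switch changes its position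
exactly if Shaper switched at time `t`. -/
def nextLaw (π : G.ControllerPolicy) (ρ : G.ShaperPolicy) (x : ShapingStep S A G.A₂) :
    PMF (ShapingStep S A G.A₂) :=
  (G.P x.state x.act).bind fun s' => stepLaw π ρ s' (xor x.switch (ρ.flip x.state))

/-- The transition kernel from the history up to time `n` to period `n + 1`. -/
def historyKernel (π : G.ControllerPolicy) (ρ : G.ShaperPolicy) (n : ℕ) :
    Kernel (Π _ : Finset.Iic n, ShapingStep S A G.A₂) (ShapingStep S A G.A₂) where
  toFun h := (nextLaw π ρ (h ⟨n, Finset.mem_Iic.2 le_rfl⟩)).toMeasure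
  measurable' :=
    (measurable_from_top (f := fun x => (nextLaw π ρ x).toMeasure)).comp (measurable_pi_apply _)

instance historyKernel.instIsMarkovKernel (π : G.ControllerPolicy) (ρ : G.ShaperPolicy) (n : ℕ) :
    IsMarkovKernel (historyKernel π ρ n) :=
  ⟨fun h => PMF.toMeasure.isProbabilityMeasure
    (nextLaw π ρ (h ⟨n, Finset.mem_Iic.2 le_rfl⟩))⟩

/-- The law of the play `(s_t, I_t, a_t, a²_t)_{t ≥ 0}` started in `(s_0, I_0) = z`. -/
def playLaw (π : G.ControllerPolicy) (ρ : G.ShaperPolicy) (z : S × Bool) :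
    Measure (ℕ → ShapingStep S A G.A₂) :=
  Kernel.trajMeasure (X := fun _ => ShapingStep S A G.A₂)
    (stepLaw π ρ z.1 z.2).toMeasure (historyKernel π ρ)

variable (G)

/-- The shaping reward `F̂(s_t, a²_t; s_{t-1}, a²_{t-1}) = φ(s_t, a²_t) - γ⁻¹ φ(s_{t-1}, a²_{t-1})`,
where `none` stands for the absence of an earlier Shaper action, which counts as the null action. -/
def shaping (s : S) (b : G.A₂) : Option (S × G.A₂) → ℝ
  | none => G.φ s b
  | some (s', b') => G.φ s b - G.γ⁻¹ * G.φ s' b'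

/-- Controller's one-period reward `R̂₁ = R + F̂ · I`. -/
def shapedReward (s : S) (i : Bool) (a : A) (b : G.A₂) (prev : Option (S × G.A₂)) : ℝ :=
  G.R s a + G.shaping s b prev * (if i then 1 else 0)

/-- The pair `(s_{t-1}, a²_{t-1})` along a play. -/
def previous (ω : ℕ → ShapingStep S A G.A₂) : ℕ → Option (S × G.A₂)
  | 0 => none
  | t + 1 => some ((ω t).state, (ω t).shaperAct)

/-- Controller's reward `R̂₁` collected in period `t` along a play. -/
def reward (ω : ℕ → ShapingStep S A G.A₂) (t : ℕ) : ℝ :=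
  G.shapedReward (ω t).state (ω t).switch (ω t).act (ω t).shaperAct (G.previous ω t)

/-- The cost incurred in period `t`: `c(1, 0)` if shaping is activated at time `t`, and no cost
otherwise. -/
def switchCost (ρ : G.ShaperPolicy) (ω : ℕ → ShapingStep S A G.A₂) (t : ℕ) : ℝ :=
  if (ω t).switch = false ∧ ρ.flip (ω t).state = true then G.c true false else 0

open Classical in
/-- The number of visits to `s_t` before time `t`. -/
def visits (ω : ℕ → ShapingStep S A G.A₂) (t : ℕ) : ℕ :=
  ((Finset.range t).filter fun j => (ω j).state = (ω t).state).card

/-- Controller's objective `v₁`. -/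
def controllerReturn (π : G.ControllerPolicy) (ρ : G.ShaperPolicy) (z : S × Bool) : ℝ :=
  ∫ ω, ∑' t, G.γ ^ t * G.reward ω t ∂(playLaw π ρ z)

/-- Shaper's objective `v₂`, including the bonus `L`. -/
def shaperReturn (π : G.ControllerPolicy) (ρ : G.ShaperPolicy) (z : S × Bool) : ℝ :=
  ∫ ω, ∑' t, G.γ ^ t *
    (G.reward ω t + G.switchCost ρ ω t + G.L (ω t).state (G.visits ω t)) ∂(playLaw π ρ z)

/-- The value `V` of a policy profile: the expected discounted sum of the shaped rewards and the
switching costs. -/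
def value (π : G.ControllerPolicy) (ρ : G.ShaperPolicy) (z : S × Bool) : ℝ :=
  ∫ ω, ∑' t, G.γ ^ t * (G.reward ω t + G.switchCost ρ ω t) ∂(playLaw π ρ z)

/-- A stable point of the game: a Markov perfect equilibrium. -/
def IsStable (π : G.ControllerPolicy) (ρ : G.ShaperPolicy) : Prop :=
  (∀ (π' : G.ControllerPolicy) (z : S × Bool),
    G.controllerReturn π' ρ z ≤ G.controllerReturn π ρ z) ∧
  (∀ (ρ' : G.ShaperPolicy) (z : S × Bool), G.shaperReturn π ρ' z ≤ G.shaperReturn π ρ z)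

/-- The intervention operator: Shaper switches now, at a cost, with null action at the switching
time, while Controller acts according to `π`. -/
def intervention [Fintype A] (π : G.ControllerPolicy) (V : S × Bool → ℝ) (z : S × Bool) : ℝ :=
  ∑ a, (π z.1 a).toReal *
    (G.shapedReward z.1 z.2 a G.null none + G.c (!z.2) z.2 +
      G.γ * ∑' s', (G.P z.1 a s').toReal * V (s', !z.2))

/-- The Bellman operator `T` of the game: the better of an intervention and of leaving the switch
as it is, with Controller then choosing the best action. -/
def bellman [Fintype A] (π : G.ControllerPolicy) (V : S × Bool → ℝ) (z : S × Bool) : ℝ :=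
  max (G.intervention π V z)
    (⨆ a : A, (G.R z.1 a + G.γ * ∑' s', (G.P z.1 a s').toReal * V (s', z.2)))

end ShapingGame

end

/-! The game decouples. Shaper's action is null unless the switch is on and is left on, so wherever
`φ` is nonzero at time `t`, the switch is on at times `t` and `t + 1`. Both indicators multiplying
that potential are then `1`, and the discounted shaping rewards telescope to a boundary term of
order `γ ^ n` (`shaping_telescopes`). Controller's return is therefore the plain environment return.

States and Controller's actions form a Markov chain whose law involves neither Shaper nor the switch
(`map_outcome_playLaw`). The environment return and the bonus thus do not depend on Shaper's policy,
which affects the value only through a nonpositive expected switching cost.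

Let `v` solve the optimality equation of the decision process `(P, R, γ)`. Environment returns are
at most `v`, with equality for a greedy policy, so values are at most `v`, with equality for a
greedy policy and a Shaper who never switches. Deviations to these two policies show that a stable
point has value `v`; the bounds give the converse (`isStable_iff`). Since interventions cost
something, `v`, read as independent of the switch, is fixed by every `T` (`bellman_optimalValue`),
and contraction gives the limit. -/

noncomputable section

/-! ### Averages against discrete laws and sup-norm contractions -/

theorem PMF.summable_toReal_mul {S : Type*} (p : PMF S) {v : S → ℝ} {K : ℝ}
    (hv : ∀ s, |v s| ≤ K) : Summable fun s => (p s).toReal * v s := by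
  have hp : Summable fun s => (p s).toReal := ENNReal.summable_toReal p.tsum_coe_ne_top
  refine Summable.of_norm_bounded (hp.mul_right K) fun s => ?_
  rw [norm_mul, Real.norm_of_nonneg ENNReal.toReal_nonneg, Real.norm_eq_abs]
  exact mul_le_mul_of_nonneg_left (hv s) ENNReal.toReal_nonneg

theorem PMF.tsum_toReal {S : Type*} (p : PMF S) : ∑' s, (p s).toReal = 1 := by
  rw [← ENNReal.tsum_toReal_eq p.apply_ne_top, p.tsum_coe, ENNReal.toReal_one]

theorem PMF.tsum_toReal_mul_le {S : Type*} (p : PMF S) {v : S → ℝ} {C K : ℝ}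
    (hv : ∀ s, |v s| ≤ K) (h : ∀ s, v s ≤ C) : ∑' s, (p s).toReal * v s ≤ C := by
  have hp : Summable fun s => (p s).toReal := ENNReal.summable_toReal p.tsum_coe_ne_top
  calc ∑' s, (p s).toReal * v s ≤ ∑' s, (p s).toReal * C :=
        (p.summable_toReal_mul hv).tsum_le_tsum
          (fun s => mul_le_mul_of_nonneg_left (h s) ENNReal.toReal_nonneg) (hp.mul_right C)
    _ = C := by rw [tsum_mul_right, p.tsum_toReal, one_mul]

theorem PMF.abs_tsum_toReal_mul_le {S : Type*} (p : PMF S) {v : S → ℝ} {K : ℝ}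
    (hv : ∀ s, |v s| ≤ K) : |∑' s, (p s).toReal * v s| ≤ K := by
  refine abs_le.2 ⟨?_, p.tsum_toReal_mul_le hv fun s => (abs_le.1 (hv s)).2⟩
  have := p.tsum_toReal_mul_le (v := fun s => -v s) (K := K) (C := K)
    (fun s => by simpa using hv s) fun s => by linarith [(abs_le.1 (hv s)).1]
  simp only [mul_neg, tsum_neg] at this
  linarith

theorem PMF.abs_tsum_toReal_mul_sub_le {S : Type*} (p : PMF S) {v w : S → ℝ} {K K' C : ℝ}
    (hv : ∀ s, |v s| ≤ K) (hw : ∀ s, |w s| ≤ K') (h : ∀ s, |v s - w s| ≤ C) :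
    |∑' s, (p s).toReal * v s - ∑' s, (p s).toReal * w s| ≤ C := by
  rw [← (p.summable_toReal_mul hv).tsum_sub (p.summable_toReal_mul hw)]
  simp only [← mul_sub]
  exact p.abs_tsum_toReal_mul_le h

theorem abs_ciSup_sub_ciSup_le {ι : Type*} [Finite ι] [Nonempty ι] {f g : ι → ℝ} {C : ℝ}
    (h : ∀ i, |f i - g i| ≤ C) : |(⨆ i, f i) - ⨆ i, g i| ≤ C := by
  have key : ∀ f g : ι → ℝ, (∀ i, |f i - g i| ≤ C) → ⨆ i, f i ≤ (⨆ i, g i) + C :=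
    fun f g h => ciSup_le fun i => by
      linarith [(abs_le.1 (h i)).2, le_ciSup (Set.finite_range g).bddAbove i]
  have h₁ := key f g h
  have h₂ := key g f fun i => abs_sub_comm (f i) (g i) ▸ h i
  exact abs_le.2 ⟨by linarith, by linarith⟩

/-- The Banach fixed point theorem for the sup norm on bounded real functions. -/
theorem exists_bounded_fixedPoint {X : Type*} {T : (X → ℝ) → X → ℝ} {γ : ℝ} (hγ : 0 ≤ γ)
    (hγ' : γ < 1) (hT : ∀ v, (∃ K, ∀ x, |v x| ≤ K) → ∃ K, ∀ x, |T v x| ≤ K)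
    (hc : ∀ v w C, (∃ K, ∀ x, |v x| ≤ K) → (∃ K, ∀ x, |w x| ≤ K) → (∀ x, |v x - w x| ≤ C) →
      ∀ x, |T v x - T w x| ≤ γ * C) :
    ∃ v, (∃ K, ∀ x, |v x| ≤ K) ∧ T v = v := by
  -- In the discrete topology every bounded function is bounded continuous, which provides a
  -- complete metric space.
  let _ : TopologicalSpace X := ⊥
  have : DiscreteTopology X := ⟨rfl⟩
  have hb : ∀ f : BoundedContinuousFunction X ℝ, ∃ K, ∀ x, |f x| ≤ K :=
    fun f => ⟨‖f‖, fun x => f.norm_coe_le_norm x⟩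
  choose K hK using fun f : BoundedContinuousFunction X ℝ => hT f (hb f)
  let Φ : BoundedContinuousFunction X ℝ → BoundedContinuousFunction X ℝ := fun f =>
    BoundedContinuousFunction.ofNormedAddCommGroupDiscrete (T f) (K f) (hK f)
  have hΦ : ContractingWith ⟨γ, hγ⟩ Φ := by
    refine ⟨by exact_mod_cast hγ', LipschitzWith.of_dist_le_mul fun f g => ?_⟩
    refine (BoundedContinuousFunction.dist_le (by positivity)).2 fun x => ?_
    exact hc f g (dist f g) (hb f) (hb g) (fun x => f.dist_coe_le_dist x) x
  refine ⟨hΦ.fixedPoint, hb _, funext fun x => ?_⟩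
  exact DFunLike.congr_fun (hΦ.fixedPoint_isFixedPt : Φ _ = _) x

theorem tendstoUniformly_iterate_of_contracting {X : Type*} {T : (X → ℝ) → X → ℝ} {γ : ℝ}
    (hγ : 0 ≤ γ) (hγ' : γ < 1)
    (hc : ∀ v w C, (∃ K, ∀ x, |v x| ≤ K) → (∃ K, ∀ x, |w x| ≤ K) → (∀ x, |v x - w x| ≤ C) →
      ∀ x, |T v x - T w x| ≤ γ * C) {v w : X → ℝ} (hv : ∃ K, ∀ x, |v x| ≤ K) (hTv : T v = v)
    (hw : ∃ K, ∀ x, |w x| ≤ K) : TendstoUniformly (fun k : ℕ => T^[k] w) v atTop := by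
  obtain ⟨K, hK⟩ := hv
  obtain ⟨K', hK'⟩ := hw
  have key : ∀ k : ℕ, ∀ x, |T^[k] w x - v x| ≤ γ ^ k * (K' + K) := by
    intro k
    induction k with
    | zero => intro x; simpa using (abs_sub _ _).trans (add_le_add (hK' x) (hK x))
    | succ k ih =>
      intro x
      -- The iterates stay bounded because they are close to the bounded fixed point; no separate
      -- hypothesis on `T` is needed.
      have hbd : ∃ M, ∀ x, |T^[k] w x| ≤ M := ⟨γ ^ k * (K' + K) + K, fun x => by
        have := abs_add_le (T^[k] w x - v x) (v x)
        rw [sub_add_cancel] at this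
        linarith [ih x, hK x]⟩
      have := hc _ _ _ hbd ⟨K, hK⟩ ih x
      rwa [hTv, ← Function.iterate_succ_apply' T k w, ← mul_assoc, ← pow_succ'] at this
  rw [Metric.tendstoUniformly_iff]
  intro ε hε
  have hlim : Tendsto (fun k : ℕ => γ ^ k * (K' + K)) atTop (𝓝 0) := by
    simpa using (tendsto_pow_atTop_nhds_zero_of_lt_one hγ hγ').mul_const (K' + K)
  filter_upwards [hlim.eventually_lt_const hε] with k hk x
  rw [dist_comm]
  exact (key k x).trans_lt hk

/-! ### The Bellman operator and the optimality equation -/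

namespace ShapingGame

variable {S A : Type*} {p : ℕ} (G : ShapingGame S A p)

/-- The reward of a period plus the discounted expectation of `v` at the next state. -/
def actionValue (v : S → ℝ) (s : S) (a : A) : ℝ :=
  G.R s a + G.γ * ∑' s', (G.P s a s').toReal * v s'

theorem abs_actionValue_sub_le {v w : S → ℝ} {C K K' : ℝ} (hv : ∀ s, |v s| ≤ K)
    (hw : ∀ s, |w s| ≤ K') (h : ∀ s, |v s - w s| ≤ C) (s : S) (a : A) :
    |G.actionValue v s a - G.actionValue w s a| ≤ G.γ * C := by
  rw [actionValue, actionValue, add_sub_add_left_eq_sub, ← mul_sub, abs_mul, abs_of_pos G.γ_pos]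
  exact mul_le_mul_of_nonneg_left ((G.P s a).abs_tsum_toReal_mul_sub_le hv hw h) G.γ_pos.le

/-- With a null action and no predecessor the shaping term is `φ(s, 0) = 0`, so only the cost
separates an intervention from an average of action values. -/
theorem intervention_eq [Fintype A] (π : G.ControllerPolicy) (V : S × Bool → ℝ) (z : S × Bool) :
    G.intervention π V z = ∑ a, (π z.1 a).toReal *
      (G.actionValue (fun s => V (s, !z.2)) z.1 a + G.c (!z.2) z.2) := by
  refine Finset.sum_congr rfl fun a _ => ?_
  have : G.φ z.1 G.null = 0 := G.φ_zero z.1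
  simp only [shapedReward, shaping, this, actionValue]
  ring

theorem abs_bellman_sub_le [Fintype A] [Nonempty A] (π : G.ControllerPolicy) (V W : S × Bool → ℝ)
    (C : ℝ) (hV : ∃ K, ∀ z, |V z| ≤ K) (hW : ∃ K, ∀ z, |W z| ≤ K) (h : ∀ z, |V z - W z| ≤ C)
    (z : S × Bool) : |G.bellman π V z - G.bellman π W z| ≤ G.γ * C := by
  obtain ⟨K, hK⟩ := hV
  obtain ⟨K', hK'⟩ := hW
  refine (abs_max_sub_max_le_max _ _ _ _).trans (max_le ?_ ?_)
  · rw [intervention_eq, intervention_eq, ← tsum_fintype (L := .unconditional A),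
      ← tsum_fintype (L := .unconditional A)]
    -- These bounds only secure summability, automatic on a finite set; their values play no role.
    have hb : ∀ f : A → ℝ, ∃ M, ∀ a, |f a| ≤ M := fun f =>
      ⟨∑ a, |f a|, fun a => Finset.single_le_sum (f := fun a => |f a|)
        (fun _ _ => abs_nonneg _) (Finset.mem_univ a)⟩
    refine (π z.1).abs_tsum_toReal_mul_sub_le (hb _).choose_spec (hb _).choose_spec fun a => ?_
    rw [add_sub_add_right_eq_sub]
    exact G.abs_actionValue_sub_le (fun s => hK _) (fun s => hK' _) (fun s => h _) _ _
  · exact abs_ciSup_sub_ciSup_le fun a =>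
      G.abs_actionValue_sub_le (fun s => hK _) (fun s => hK' _) (fun s => h _) _ _

/-- The optimality equation of the Markov decision process `(P, R, γ)` has a bounded solution. -/
theorem exists_optimalValue [Finite A] [Nonempty A] :
    ∃ v : S → ℝ, (∃ K, ∀ s, |v s| ≤ K) ∧ ∀ s, ⨆ a, G.actionValue v s a = v s := by
  simp only [← funext_iff]
  refine exists_bounded_fixedPoint (T := fun v s => ⨆ a, G.actionValue v s a)
    G.γ_pos.le G.γ_lt_one ?_ ?_
  · rintro v ⟨K, hK⟩
    obtain ⟨C, hC⟩ := G.R_bounded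
    refine ⟨C + G.γ * K, fun s => ?_⟩
    have := abs_ciSup_sub_ciSup_le (f := G.actionValue v s) (g := fun _ => 0) (C := C + G.γ * K)
      fun a => by
        rw [sub_zero]
        refine (abs_add_le _ _).trans (add_le_add (hC s a) ?_)
        rw [abs_mul, abs_of_pos G.γ_pos]
        exact mul_le_mul_of_nonneg_left ((G.P s a).abs_tsum_toReal_mul_le hK) G.γ_pos.le
    simpa using this
  · rintro v w C ⟨K, hK⟩ ⟨K', hK'⟩ h s
    exact abs_ciSup_sub_ciSup_le fun a => G.abs_actionValue_sub_le hK hK' h s a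

/-- Because `v` ignores the switch, intervening yields an average of action values, each at most
`v`, plus a negative cost. It never beats the maximum over actions, whatever `π` is. -/
theorem bellman_optimalValue [Fintype A] [Nonempty A] {v : S → ℝ}
    (h : ∀ s, ⨆ a, G.actionValue v s a = v s) (π : G.ControllerPolicy) :
    G.bellman π (fun z => v z.1) = fun z => v z.1 := by
  funext z
  have hle : G.intervention π (fun z => v z.1) z ≤ v z.1 := by
    rw [intervention_eq]
    calc _ ≤ ∑ a, (π z.1 a).toReal * v z.1 := by
          refine Finset.sum_le_sum fun a _ =>
            mul_le_mul_of_nonneg_left ?_ ENNReal.toReal_nonneg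
          have h₁ := le_ciSup (Set.finite_range (G.actionValue v z.1)).bddAbove a
          rw [h] at h₁
          linarith [G.c_neg (!z.2) z.2]
      _ = v z.1 := by
          rw [← Finset.sum_mul, ← tsum_fintype (L := .unconditional A), PMF.tsum_toReal, one_mul]
  have hs : (⨆ a : A, (G.R z.1 a + G.γ * ∑' s', (G.P z.1 a s').toReal * v s')) = v z.1 := h z.1
  rw [bellman, hs, max_eq_right hle]

end ShapingGame

/-! ### Trajectory measures of Markov chains with discrete transition laws -/

theorem ProbabilityTheory.Kernel.trajMeasure_map_zero {X : Type*} [MeasurableSpace X]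
    {κ : (n : ℕ) → Kernel (Π _ : Finset.Iic n, X) X} [∀ n, IsMarkovKernel (κ n)]
    (μ₀ : Measure X) [IsProbabilityMeasure μ₀] :
    (Kernel.trajMeasure (X := fun _ => X) μ₀ κ).map (fun ω => ω 0) = μ₀ := by
  have h0 : (fun ω : ℕ → X => ω 0) =
      (fun x : Π _ : Finset.Iic 0, X => x ⟨0, Finset.mem_Iic.2 le_rfl⟩) ∘
        Preorder.frestrictLe (π := fun _ => X) 0 := rfl
  rw [h0, ← Measure.map_map (by fun_prop) (by fun_prop), Kernel.trajMeasure,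
    Measure.map_comp _ _ (by fun_prop), Kernel.traj_map_frestrictLe, Kernel.partialTraj_self,
    Measure.id_comp]
  exact (Measure.map_map (measurable_pi_apply _) (MeasurableEquiv.measurable _)).trans Measure.map_id

/-- Both measures are projective limits of the family of finite-dimensional marginals of `ν`, and
such a limit is unique. -/
theorem MeasureTheory.Measure.ext_of_map_frestrictLe {D : Type*} [MeasurableSpace D]
    {μ ν : Measure (ℕ → D)} [IsFiniteMeasure μ] [IsFiniteMeasure ν]
    (h : ∀ n, μ.map (Preorder.frestrictLe (π := fun _ => D) n) =
      ν.map (Preorder.frestrictLe (π := fun _ => D) n)) : μ = ν := by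
  have hp : IsProjectiveMeasureFamily (α := fun _ : ℕ => D) fun I => ν.map I.restrict := by
    intro I J hJI
    exact (Measure.map_map (Finset.measurable_restrict₂ hJI) (Finset.measurable_restrict I)).symm
  exact ((isProjectiveLimit_nat_iff hp μ).2 h).unique
    ((isProjectiveLimit_nat_iff hp ν).2 fun _ => rfl)

section MarkovChain

variable {X D E : Type*} [MeasurableSpace X] [DiscreteMeasurableSpace X]
  {κ : (n : ℕ) → Kernel (Π _ : Finset.Iic n, X) X} [∀ n, IsMarkovKernel (κ n)]
  {K : X → PMF X} {p₀ : PMF X}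

theorem measurable_comp_eval [MeasurableSpace E] (f : X → E) (n : ℕ) :
    Measurable fun ω : ℕ → X => f (ω n) :=
  (Measurable.of_discrete (f := f)).comp (measurable_pi_apply n)

/-- The joint law of the path up to time `n` and the next state of a Markov chain with discrete
transition laws. -/
theorem map_trajMeasure_succ
    (hκ : ∀ n h, κ n h = (K (h ⟨n, Finset.mem_Iic.2 le_rfl⟩)).toMeasure)
    {n : ℕ} {s : Set (Π _ : Finset.Iic n, X)} {t : Set X} (hs : MeasurableSet s) :
    Kernel.trajMeasure (X := fun _ => X) p₀.toMeasure κ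
        {ω | Preorder.frestrictLe (π := fun _ => X) n ω ∈ s ∧ ω (n + 1) ∈ t} =
      ∫⁻ ω in {ω | Preorder.frestrictLe (π := fun _ => X) n ω ∈ s}, (K (ω n)).toMeasure t
        ∂Kernel.trajMeasure (X := fun _ => X) p₀.toMeasure κ := by
  have h := congrArg (fun μ => μ (s ×ˢ t))
    (Kernel.map_frestrictLe_trajMeasure_compProd_eq_map_trajMeasure (X := fun _ => X)
      (μ₀ := p₀.toMeasure) (κ := κ) (a := n))
  rw [Measure.compProd_apply_prod hs .of_discrete, Measure.map_apply (by fun_prop)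
    (hs.prod .of_discrete), setLIntegral_map hs (Kernel.measurable_coe _ .of_discrete)
    (by fun_prop)] at h
  simp only [hκ] at h
  exact h.symm

theorem ae_trajMeasure_zero {q : X → Prop} (h : ∀ x ∈ p₀.support, q x) :
    ∀ᵐ ω ∂Kernel.trajMeasure (X := fun _ => X) p₀.toMeasure κ, q (ω 0) := by
  have h₀ := Kernel.trajMeasure_map_zero (X := X) (κ := κ) p₀.toMeasure
  have : ∀ᵐ x ∂p₀.toMeasure, q x := by
    rw [ae_iff, PMF.toMeasure_apply_eq_zero_iff _ .of_discrete, Set.disjoint_left]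
    exact fun x hx hq => hq (h x hx)
  rw [← h₀] at this
  exact ae_of_ae_map (measurable_pi_apply 0).aemeasurable this

theorem ae_trajMeasure_succ
    (hκ : ∀ n h, κ n h = (K (h ⟨n, Finset.mem_Iic.2 le_rfl⟩)).toMeasure) [Countable E]
    {f g : X → E} (h : ∀ x, ∀ y ∈ (K x).support, g y = f x) :
    ∀ᵐ ω ∂Kernel.trajMeasure (X := fun _ => X) p₀.toMeasure κ, ∀ n, g (ω (n + 1)) = f (ω n) := by
  rw [ae_all_iff]
  intro n
  -- The state space may be uncountable, so the exceptional event is split along the countably many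
  -- values of `f`.
  have key : ∀ e : E, ∀ᵐ ω ∂Kernel.trajMeasure (X := fun _ => X) p₀.toMeasure κ,
      f (ω n) = e → g (ω (n + 1)) = e := by
    intro e
    have hm : MeasurableSet {x : Π _ : Finset.Iic n, X |
        f (x ⟨n, Finset.mem_Iic.2 le_rfl⟩) = e} :=
      measurableSet_preimage (f := fun x : Π _ : Finset.Iic n, X => x ⟨n, Finset.mem_Iic.2 le_rfl⟩)
        (measurable_pi_apply _) (MeasurableSet.of_discrete (s := {x : X | f x = e}))
    have := map_trajMeasure_succ (p₀ := p₀) hκ (n := n) (t := {y | g y ≠ e}) hm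
    rw [setLIntegral_congr_fun (g := fun _ => 0)] at this
    · rw [lintegral_zero] at this
      rw [ae_iff]
      convert this using 3 with ω
      simp [Preorder.frestrictLe]
    · exact Preorder.measurable_frestrictLe n hm
    · intro ω hω
      simp only
      rw [PMF.toMeasure_apply_eq_zero_iff _ .of_discrete, Set.disjoint_left]
      exact fun y hy hne => hne ((h _ y hy).trans hω)
  filter_upwards [ae_all_iff.2 key] with ω hω using hω _ rfl

theorem ae_trajMeasure_forall
    (hκ : ∀ n h, κ n h = (K (h ⟨n, Finset.mem_Iic.2 le_rfl⟩)).toMeasure) {q : X → Prop}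
    (h₀ : ∀ x ∈ p₀.support, q x) (h : ∀ x, ∀ y ∈ (K x).support, q y) :
    ∀ᵐ ω ∂Kernel.trajMeasure (X := fun _ => X) p₀.toMeasure κ, ∀ n, q (ω n) := by
  classical
  -- From time `1` on, `q` is the one-step relation between the indicator of `q` and a constant.
  filter_upwards [ae_trajMeasure_zero h₀, ae_trajMeasure_succ (p₀ := p₀) hκ
    (f := fun _ => true) (g := fun x => decide (q x)) fun x y hy => decide_eq_true (h x y hy)]
    with ω hω₀ hω n
  cases n with
  | zero => exact hω₀
  | succ n => exact of_decide_eq_true (hω n)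

theorem trajMeasure_cylinder_zero (d : X → D) (η : D) :
    Kernel.trajMeasure (X := fun _ => X) p₀.toMeasure κ {ω | d (ω 0) = η} = p₀.map d η := by
  have h₀ := Kernel.trajMeasure_map_zero (X := X) (κ := κ) p₀.toMeasure
  have h := congrArg (fun μ => μ {x | d x = η}) h₀
  rw [Measure.map_apply (by fun_prop) .of_discrete] at h
  let _ : MeasurableSpace D := ⊤
  rw [← PMF.toMeasure_apply_singleton _ _ (.of_discrete (s := {η})),
    PMF.toMeasure_map_apply _ _ _ .of_discrete .of_discrete]
  exact h

/-- Lumping: given the past, the law of the next `d`-value depends on the current state only through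
`d`, hence is constant on the cylinder and factors out. -/
theorem trajMeasure_cylinder_succ
    (hκ : ∀ n h, κ n h = (K (h ⟨n, Finset.mem_Iic.2 le_rfl⟩)).toMeasure) {d : X → D}
    {L : D → PMF D} (hd : ∀ x, (K x).map d = L (d x)) (n : ℕ) (η : ℕ → D) :
    Kernel.trajMeasure (X := fun _ => X) p₀.toMeasure κ {ω | ∀ i ≤ n + 1, d (ω i) = η i} =
      L (η n) (η (n + 1)) *
        Kernel.trajMeasure (X := fun _ => X) p₀.toMeasure κ {ω | ∀ i ≤ n, d (ω i) = η i} := by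
  have hm : MeasurableSet {x : Π _ : Finset.Iic n, X | ∀ i, d (x i) = η i} := by
    rw [Set.ofPred_forall]
    exact MeasurableSet.iInter fun i =>
      measurableSet_preimage (f := fun x : Π _ : Finset.Iic n, X => x i) (measurable_pi_apply i)
        (MeasurableSet.of_discrete (s := {x : X | d x = η i}))
  have hset : {ω : ℕ → X | Preorder.frestrictLe (π := fun _ => X) n ω ∈
      {x : Π _ : Finset.Iic n, X | ∀ i, d (x i) = η i}} = {ω | ∀ i ≤ n, d (ω i) = η i} := by
    ext ω
    simp [Preorder.frestrictLe]
  have := map_trajMeasure_succ (p₀ := p₀) hκ (n := n) (t := {y | d y = η (n + 1)}) hm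
  rw [hset, setLIntegral_congr_fun (g := fun _ => L (η n) (η (n + 1)))
    (hset ▸ Preorder.measurable_frestrictLe n hm), setLIntegral_const] at this
  · rw [← this]
    congr 1
    ext ω
    simp only [Set.mem_ofPred_eq, Nat.le_succ_iff, Preorder.frestrictLe]
    simp [or_imp, forall_and]
  · intro ω hω
    have hn : d (ω n) = η n := hω n le_rfl
    let _ : MeasurableSpace D := ⊤
    simp only
    rw [← hn, ← hd, ← PMF.toMeasure_apply_singleton _ _ (.of_discrete (s := {η (n + 1)})),
      PMF.toMeasure_map_apply _ _ _ .of_discrete .of_discrete]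
    rfl

/-- The law of a function of a Markov chain with discrete transition laws that is itself a Markov
chain with transition laws `L` is determined by `L` and the initial law. -/
theorem map_trajMeasure_eq [MeasurableSpace D] [Countable D] [DiscreteMeasurableSpace D]
    {κ' : (n : ℕ) → Kernel (Π _ : Finset.Iic n, X) X} [∀ n, IsMarkovKernel (κ' n)]
    {K' : X → PMF X} {p₀' : PMF X}
    (hκ : ∀ n h, κ n h = (K (h ⟨n, Finset.mem_Iic.2 le_rfl⟩)).toMeasure)
    (hκ' : ∀ n h, κ' n h = (K' (h ⟨n, Finset.mem_Iic.2 le_rfl⟩)).toMeasure) {d : X → D}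
    {L : D → PMF D} (hd : ∀ x, (K x).map d = L (d x)) (hd' : ∀ x, (K' x).map d = L (d x))
    (h₀ : p₀.map d = p₀'.map d) :
    (Kernel.trajMeasure (X := fun _ => X) p₀.toMeasure κ).map (fun ω n => d (ω n)) =
      (Kernel.trajMeasure (X := fun _ => X) p₀'.toMeasure κ').map fun ω n => d (ω n) := by
  have hdm : Measurable fun (ω : ℕ → X) n => d (ω n) :=
    measurable_pi_lambda _ fun n => measurable_comp_eval d n
  have hcyl : ∀ (n : ℕ) (η : ℕ → D),
      Kernel.trajMeasure (X := fun _ => X) p₀.toMeasure κ {ω | ∀ i ≤ n, d (ω i) = η i} =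
        Kernel.trajMeasure (X := fun _ => X) p₀'.toMeasure κ' {ω | ∀ i ≤ n, d (ω i) = η i} := by
    intro n η
    induction n with
    | zero => simp [trajMeasure_cylinder_zero, h₀]
    | succ n ih => rw [trajMeasure_cylinder_succ hκ hd, trajMeasure_cylinder_succ hκ' hd', ih]
  have := Measure.isProbabilityMeasure_map
    (μ := Kernel.trajMeasure (X := fun _ => X) p₀.toMeasure κ) hdm.aemeasurable
  have := Measure.isProbabilityMeasure_map
    (μ := Kernel.trajMeasure (X := fun _ => X) p₀'.toMeasure κ') hdm.aemeasurable
  -- Finite paths in `D` form a countable set, so their laws are determined by singletons, that is,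
  -- by cylinders.
  refine Measure.ext_of_map_frestrictLe fun n => Measure.ext_of_singleton fun η => ?_
  rw [Measure.map_apply (by fun_prop) (measurableSet_singleton _),
    Measure.map_apply (by fun_prop) (measurableSet_singleton _),
    Measure.map_apply hdm (Preorder.measurable_frestrictLe n (measurableSet_singleton _)),
    Measure.map_apply hdm (Preorder.measurable_frestrictLe n (measurableSet_singleton _))]
  -- The truncation `min i n` extends a finite path to all of `ℕ`; the values after `n` are
  -- irrelevant.
  have hset : (fun (ω : ℕ → X) n => d (ω n)) ⁻¹'
      (Preorder.frestrictLe (π := fun _ => D) n ⁻¹' {η}) =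
      {ω | ∀ i ≤ n, d (ω i) = η ⟨min i n, Finset.mem_Iic.2 (min_le_right i n)⟩} := by
    ext ω
    simp only [Set.mem_preimage, Set.mem_singleton_iff, funext_iff, Preorder.frestrictLe,
      Finset.restrict, Set.mem_ofPred_eq]
    refine ⟨fun h i hi => ?_, fun h i => ?_⟩
    · simpa [min_eq_left hi] using h ⟨i, Finset.mem_Iic.2 hi⟩
    · have hi := Finset.mem_Iic.1 i.2
      simpa [min_eq_left hi] using h i hi
  rw [hset]
  exact hcyl n _

end MarkovChain

/-- The tower property: the joint law of the past and the next state is a composition-product, to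
which Fubini applies. -/
theorem integral_trajMeasure_succ {X : Type*} [MeasurableSpace X] [DiscreteMeasurableSpace X]
    {κ : (n : ℕ) → Kernel (Π _ : Finset.Iic n, X) X} [∀ n, IsMarkovKernel (κ n)]
    {K : X → PMF X} {p₀ : PMF X}
    (hκ : ∀ n h, κ n h = (K (h ⟨n, Finset.mem_Iic.2 le_rfl⟩)).toMeasure) {g : X → ℝ} {C : ℝ}
    (hg : ∀ x, |g x| ≤ C) (n : ℕ) :
    ∫ ω, g (ω (n + 1)) ∂Kernel.trajMeasure (X := fun _ => X) p₀.toMeasure κ =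
      ∫ ω, (∫ y, g y ∂(K (ω n)).toMeasure)
        ∂Kernel.trajMeasure (X := fun _ => X) p₀.toMeasure κ := by
  have h := Kernel.map_frestrictLe_trajMeasure_compProd_eq_map_trajMeasure (X := fun _ => X)
      (μ₀ := p₀.toMeasure) (κ := κ) (a := n)
  have hgm : Measurable fun x : (Π _ : Finset.Iic n, X) × X => g x.2 :=
    (Measurable.of_discrete (f := g)).comp measurable_snd
  have hmap : Measurable fun ω : ℕ → X =>
      (Preorder.frestrictLe (π := fun _ => X) n ω, ω (n + 1)) := by fun_prop
  have := Measure.isProbabilityMeasure_map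
    (μ := Kernel.trajMeasure (X := fun _ => X) p₀.toMeasure κ)
    (Preorder.measurable_frestrictLe (X := fun _ => X) n).aemeasurable
  calc ∫ ω, g (ω (n + 1)) ∂Kernel.trajMeasure (X := fun _ => X) p₀.toMeasure κ
      = ∫ x, g x.2 ∂(Kernel.trajMeasure (X := fun _ => X) p₀.toMeasure κ).map
          (fun ω => (Preorder.frestrictLe (π := fun _ => X) n ω, ω (n + 1))) :=
        (integral_map hmap.aemeasurable hgm.aestronglyMeasurable).symm
    _ = ∫ h, (∫ y, g y ∂κ n h) ∂(Kernel.trajMeasure (X := fun _ => X) p₀.toMeasure κ).map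
          (Preorder.frestrictLe (π := fun _ => X) n) := by
        rw [← h, Measure.integral_compProd]
        exact Integrable.of_bound hgm.aestronglyMeasurable C (.of_forall fun x => hg x.2)
    _ = _ := by
        rw [integral_map (by fun_prop)]
        · simp only [hκ]
          rfl
        · exact hgm.stronglyMeasurable.integral_kernel_prod_right'.aestronglyMeasurable

theorem PMF.integral_toMeasure_eq_tsum_of_map_eq {X S : Type*} [MeasurableSpace X]
    [DiscreteMeasurableSpace X] {q : PMF X} {d : X → S} {r : PMF S} (h : q.map d = r) {v : S → ℝ}
    {C : ℝ} (hv : ∀ s, |v s| ≤ C) : ∫ x, v (d x) ∂q.toMeasure = ∑' s, (r s).toReal * v s := by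
  let _ : MeasurableSpace S := ⊤
  have hd : Measurable d := .of_discrete
  have hvm : Measurable v := .of_discrete
  subst h
  rw [← integral_map (φ := d) hd.aemeasurable hvm.aestronglyMeasurable, PMF.toMeasure_map _ _ hd,
    PMF.integral_eq_tsum]
  · rfl
  · exact Integrable.of_bound hvm.aestronglyMeasurable C (.of_forall hv)

/-! ### Discounted sums of uniformly bounded random variables -/

section DiscountedSum

variable {Ω : Type*} [MeasurableSpace Ω] {μ : Measure Ω} [IsProbabilityMeasure μ]
  {F : ℕ → Ω → ℝ} {γ C : ℝ}

theorem summable_discounted {f : ℕ → ℝ} (hγ : 0 ≤ γ) (hγ' : γ < 1) (hf : ∀ t, |f t| ≤ C) :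
    Summable fun t => γ ^ t * f t := by
  refine .of_norm_bounded ((summable_geometric_of_lt_one hγ hγ').mul_right C) fun t => ?_
  rw [norm_mul, Real.norm_of_nonneg (pow_nonneg hγ t)]
  exact mul_le_mul_of_nonneg_left (hf t) (pow_nonneg hγ t)

theorem integrable_discounted (hm : ∀ t, Measurable (F t)) (hF : ∀ t ω, |F t ω| ≤ C)
    (t : ℕ) : Integrable (fun ω => γ ^ t * F t ω) μ :=
  (Integrable.of_bound (hm t).aestronglyMeasurable C (.of_forall (hF t))).const_mul _

theorem measurable_discountedSum (hγ : 0 ≤ γ) (hγ' : γ < 1) (hm : ∀ t, Measurable (F t))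
    (hF : ∀ t ω, |F t ω| ≤ C) : Measurable fun ω => ∑' t, γ ^ t * F t ω := by
  refine measurable_of_tendsto_metrizable
    (f := fun (n : ℕ) ω => ∑ t ∈ Finset.range n, γ ^ t * F t ω)
    (fun n => Finset.measurable_sum _ fun t _ => (hm t).const_mul _) (tendsto_pi_nhds.2 fun ω => ?_)
  exact (summable_discounted hγ hγ' fun t => hF t ω).hasSum.tendsto_sum_nat

theorem integrable_discountedSum (hγ : 0 ≤ γ) (hγ' : γ < 1) (hm : ∀ t, Measurable (F t))
    (hF : ∀ t ω, |F t ω| ≤ C) : Integrable (fun ω => ∑' t, γ ^ t * F t ω) μ := by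
  refine Integrable.of_bound (measurable_discountedSum hγ hγ' hm hF).aestronglyMeasurable
    (∑' t, γ ^ t * C) (.of_forall fun ω => ?_)
  refine tsum_of_norm_bounded ((summable_geometric_of_lt_one hγ hγ').mul_right C).hasSum fun t => ?_
  rw [norm_mul, Real.norm_of_nonneg (pow_nonneg hγ t)]
  exact mul_le_mul_of_nonneg_left (hF t ω) (pow_nonneg hγ t)

theorem hasSum_integral_discounted (hγ : 0 ≤ γ) (hγ' : γ < 1) (hm : ∀ t, Measurable (F t))
    (hF : ∀ t ω, |F t ω| ≤ C) :
    HasSum (fun t => γ ^ t * ∫ ω, F t ω ∂μ) (∫ ω, ∑' t, γ ^ t * F t ω ∂μ) := by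
  simp only [← integral_const_mul]
  refine hasSum_integral_of_summable_integral_norm (integrable_discounted hm hF) ?_
  simp only [norm_mul, Real.norm_of_nonneg (pow_nonneg hγ _), integral_const_mul]
  refine summable_discounted (C := C) hγ hγ' fun t => ?_
  rw [abs_of_nonneg (integral_nonneg fun _ => norm_nonneg _)]
  calc ∫ ω, ‖F t ω‖ ∂μ ≤ ∫ _, C ∂μ := integral_mono_of_nonneg (.of_forall fun _ => norm_nonneg _)
        (integrable_const C) (.of_forall (hF t))
    _ = C := by simp

end DiscountedSum

/-! ### The law of a play and its independence of Shaper -/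

instance ShapingStep.instDiscreteMeasurableSpace (S A B : Type*) :
    DiscreteMeasurableSpace (ShapingStep S A B) := ⟨fun _ => trivial⟩

namespace ShapingGame

variable {S A : Type*} {p : ℕ} {G : ShapingGame S A p}

/-- The part of a period that does not involve Shaper. -/
def outcome (x : ShapingStep S A G.A₂) : S × A := (x.state, x.act)

/-- The transition law of the Markov chain of states and Controller's actions. -/
def outcomeLaw (π : G.ControllerPolicy) (x : S × A) : PMF (S × A) :=
  (G.P x.1 x.2).bind fun s => (π s).map (Prod.mk s)

/-- Shaper's action and the switch are forgotten, leaving a law free of `ρ` and `i`. This is the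
lumping property behind `map_outcome_playLaw`. -/
theorem map_outcome_stepLaw (π : G.ControllerPolicy) (ρ : G.ShaperPolicy) (s : S) (i : Bool) :
    (stepLaw π ρ s i).map outcome = (π s).map (Prod.mk s) := by
  rw [stepLaw, PMF.map_bind]
  simp only [PMF.map_comp]
  exact congrArg (PMF.bind _) (funext fun a => PMF.map_const _ (s, a))

theorem map_outcome_nextLaw (π : G.ControllerPolicy) (ρ : G.ShaperPolicy)
    (x : ShapingStep S A G.A₂) : (nextLaw π ρ x).map outcome = outcomeLaw π (outcome x) := by
  rw [nextLaw, PMF.map_bind]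
  simp only [map_outcome_stepLaw]
  rfl

theorem map_state_nextLaw (π : G.ControllerPolicy) (ρ : G.ShaperPolicy)
    (x : ShapingStep S A G.A₂) :
    (nextLaw π ρ x).map ShapingStep.state = G.P x.state x.act := by
  have h := congrArg (PMF.map Prod.fst) (map_outcome_nextLaw π ρ x)
  rw [PMF.map_comp, outcomeLaw, PMF.map_bind] at h
  refine h.trans ?_
  simp only [PMF.map_comp]
  exact (congrArg (PMF.bind _) (funext fun s => PMF.map_const _ s)).trans (PMF.bind_pure _)

theorem of_mem_support_stepLaw {π : G.ControllerPolicy} {ρ : G.ShaperPolicy} {s : S} {i : Bool}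
    {x : ShapingStep S A G.A₂} (hx : x ∈ (stepLaw π ρ s i).support) :
    x.state = s ∧ x.switch = i ∧ x.act ∈ (π s).support ∧
      (x.shaperAct = G.null ∨ i = true ∧ ρ.flip s = false) := by
  simp only [stepLaw, PMF.mem_support_bind_iff, PMF.mem_support_map_iff] at hx
  obtain ⟨a, ha, b, hb, rfl⟩ := hx
  refine ⟨rfl, rfl, ha, ?_⟩
  split_ifs at hb with h
  · exact .inr h
  · exact .inl ((PMF.mem_support_pure_iff _ _).1 hb)

theorem of_mem_support_nextLaw {π : G.ControllerPolicy} {ρ : G.ShaperPolicy}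
    {x y : ShapingStep S A G.A₂} (hy : y ∈ (nextLaw π ρ x).support) :
    ∃ s, y ∈ (stepLaw π ρ s (xor x.switch (ρ.flip x.state))).support := by
  obtain ⟨s, -, hs⟩ := (PMF.mem_support_bind_iff _ _ _).1 hy
  exact ⟨s, hs⟩

instance playLaw.instIsProbabilityMeasure (π : G.ControllerPolicy) (ρ : G.ShaperPolicy)
    (z : S × Bool) : IsProbabilityMeasure (playLaw π ρ z) := by
  unfold playLaw
  infer_instance

theorem ae_playLaw_zero (π : G.ControllerPolicy) (ρ : G.ShaperPolicy) (z : S × Bool) :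
    ∀ᵐ ω ∂playLaw π ρ z, (ω 0).state = z.1 ∧ (ω 0).switch = z.2 :=
  ae_trajMeasure_zero (κ := historyKernel π ρ) (p₀ := stepLaw π ρ z.1 z.2)
    (q := fun x => x.state = z.1 ∧ x.switch = z.2) fun _ hx =>
    ⟨(of_mem_support_stepLaw hx).1, (of_mem_support_stepLaw hx).2.1⟩

theorem ae_playLaw_switch (π : G.ControllerPolicy) (ρ : G.ShaperPolicy) (z : S × Bool) :
    ∀ᵐ ω ∂playLaw π ρ z, ∀ t, (ω (t + 1)).switch = xor (ω t).switch (ρ.flip (ω t).state) :=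
  ae_trajMeasure_succ (κ := historyKernel π ρ) (p₀ := stepLaw π ρ z.1 z.2) (K := nextLaw π ρ)
    (fun _ _ => rfl) (g := fun x => x.switch)
    (f := fun x => xor x.switch (ρ.flip x.state)) fun _ _ hy =>
      let ⟨_, hs⟩ := of_mem_support_nextLaw hy
      (of_mem_support_stepLaw hs).2.1

theorem ae_playLaw_forall {π : G.ControllerPolicy} {ρ : G.ShaperPolicy} (z : S × Bool)
    {q : ShapingStep S A G.A₂ → Prop} (h : ∀ s i, ∀ x ∈ (stepLaw π ρ s i).support, q x) :
    ∀ᵐ ω ∂playLaw π ρ z, ∀ t, q (ω t) :=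
  ae_trajMeasure_forall (κ := historyKernel π ρ) (p₀ := stepLaw π ρ z.1 z.2) (K := nextLaw π ρ)
     (fun _ _ => rfl) (h _ _) fun _ y hy =>
    let ⟨_, hs⟩ := of_mem_support_nextLaw hy
    h _ _ y hs

/-- Shaper has no influence on the law of the states and of Controller's actions. -/
theorem map_outcome_playLaw [Countable S] [Countable A] [MeasurableSpace S] [MeasurableSpace A]
    [DiscreteMeasurableSpace S] [DiscreteMeasurableSpace A] (π : G.ControllerPolicy)
    (ρ ρ' : G.ShaperPolicy) (s : S) (i j : Bool) :
    (playLaw π ρ (s, i)).map (fun ω t => outcome (ω t)) =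
      (playLaw π ρ' (s, j)).map fun ω t => outcome (ω t) :=
  map_trajMeasure_eq (κ := historyKernel π ρ) (κ' := historyKernel π ρ')
    (p₀ := stepLaw π ρ s i) (p₀' := stepLaw π ρ' s j) (K := nextLaw π ρ)
     (K' := nextLaw π ρ') (L := outcomeLaw π) (fun _ _ => rfl)
    (fun _ _ => rfl) (map_outcome_nextLaw π ρ) (map_outcome_nextLaw π ρ')
    (by rw [map_outcome_stepLaw, map_outcome_stepLaw])

theorem integral_outcome_playLaw [Countable S] [Countable A] [MeasurableSpace S]
    [MeasurableSpace A] [DiscreteMeasurableSpace S] [DiscreteMeasurableSpace A]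
    (π : G.ControllerPolicy) (ρ ρ' : G.ShaperPolicy) (s : S) (i j : Bool)
    {F : (ℕ → S × A) → ℝ} (hF : Measurable F) :
    ∫ ω, F (fun t => outcome (ω t)) ∂playLaw π ρ (s, i) =
      ∫ ω, F (fun t => outcome (ω t)) ∂playLaw π ρ' (s, j) := by
  have hm : Measurable fun (ω : ℕ → ShapingStep S A G.A₂) t => outcome (ω t) :=
    measurable_pi_lambda _ fun t => measurable_comp_eval outcome t
  rw [← integral_map hm.aemeasurable hF.aestronglyMeasurable,
    ← integral_map hm.aemeasurable hF.aestronglyMeasurable, map_outcome_playLaw π ρ ρ' s i j]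

/-! ### Cancellation of the shaping rewards and decomposition of the returns -/

variable (G)

/-- The potential of period `t` enters with weight `γ ^ t` at time `t` and `-γ ^ (t + 1) * γ⁻¹` at
time `t + 1`. These cancel once both switch indicators can be dropped, leaving only the last
potential. -/
theorem shaping_telescopes {ω : ℕ → ShapingStep S A G.A₂} {ρ : G.ShaperPolicy}
    (hs : ∀ t, (ω (t + 1)).switch = xor (ω t).switch (ρ.flip (ω t).state))
    (hb : ∀ t, (ω t).shaperAct = G.null ∨
      (ω t).switch = true ∧ ρ.flip (ω t).state = false) (n : ℕ) :
    ∑ t ∈ Finset.range (n + 1), G.γ ^ t * G.reward ω t =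
      ∑ t ∈ Finset.range (n + 1), G.γ ^ t * G.R (ω t).state (ω t).act +
        G.γ ^ n * G.φ (ω n).state (ω n).shaperAct := by
  have hnull : ∀ s, G.φ s G.null = 0 := G.φ_zero
  have hγ := G.γ_pos.ne'
  have hon : ∀ t, G.φ (ω t).state (ω t).shaperAct * (if (ω t).switch then 1 else 0) =
      G.φ (ω t).state (ω t).shaperAct := by
    intro t
    rcases hb t with h | h <;> simp [h, hnull]
  -- A non-null action excludes a flip at time `t`, so the switch is still on at time `t + 1`.
  have hon' : ∀ t, G.φ (ω t).state (ω t).shaperAct * (if (ω (t + 1)).switch then 1 else 0) =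
      G.φ (ω t).state (ω t).shaperAct := by
    intro t
    rcases hb t with h | h <;> simp [h, hnull, hs]
  induction n with
  | zero => simpa [reward, shapedReward, previous, shaping] using hon 0
  | succ n ih =>
    rw [Finset.sum_range_succ, ih, Finset.sum_range_succ _ (n + 1)]
    simp only [reward, shapedReward, previous, shaping, sub_mul, hon, mul_assoc, hon', pow_succ]
    field_simp
    ring

theorem exists_abs_reward_le : ∃ C, ∀ ω t, |G.reward ω t| ≤ C := by
  obtain ⟨C, hC⟩ := G.R_bounded
  obtain ⟨D, hD⟩ := G.φ_bounded
  refine ⟨C + (D + G.γ⁻¹ * D), fun ω t => (abs_add_le _ _).trans (add_le_add (hC _ _) ?_)⟩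
  have hγ := inv_nonneg.2 G.γ_pos.le
  have hD0 : 0 ≤ D := (abs_nonneg _).trans (hD (ω 0).state G.null)
  have hle : |G.shaping (ω t).state (ω t).shaperAct (G.previous ω t)| ≤ D + G.γ⁻¹ * D := by
    cases t with
    | zero => exact (hD _ _).trans (le_add_of_nonneg_right (by positivity))
    | succ t =>
      refine (abs_sub _ _).trans (add_le_add (hD _ _) ?_)
      rw [abs_mul, abs_of_nonneg hγ]
      exact mul_le_mul_of_nonneg_left (hD _ _) hγ
  split_ifs
  · simpa using hle
  · simpa using add_nonneg hD0 (mul_nonneg hγ hD0)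

theorem measurable_reward (t : ℕ) : Measurable fun ω => G.reward ω t := by
  cases t with
  | zero =>
    exact measurable_comp_eval
      (fun x : ShapingStep S A G.A₂ => G.shapedReward x.state x.switch x.act x.shaperAct none) 0
  | succ t =>
    refine (measurable_comp_eval (fun x : ShapingStep S A G.A₂ => G.R x.state x.act)
      (t + 1)).add (Measurable.mul ?_ (measurable_comp_eval
        (fun x : ShapingStep S A G.A₂ => if x.switch then (1 : ℝ) else 0) (t + 1)))
    have hφ : ∀ j, Measurable fun ω : ℕ → ShapingStep S A G.A₂ =>
        G.φ (ω j).state (ω j).shaperAct :=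
      measurable_comp_eval fun x : ShapingStep S A G.A₂ => G.φ x.state x.shaperAct
    exact (hφ (t + 1)).sub ((hφ t).const_mul G.γ⁻¹)

theorem measurable_switchCost (ρ : G.ShaperPolicy) (t : ℕ) :
    Measurable fun ω => G.switchCost ρ ω t :=
  measurable_comp_eval (fun x : ShapingStep S A G.A₂ =>
    if x.switch = false ∧ ρ.flip x.state = true then G.c true false else 0) t

theorem abs_switchCost_le (ρ : G.ShaperPolicy) (ω : ℕ → ShapingStep S A G.A₂) (t : ℕ) :
    |G.switchCost ρ ω t| ≤ |G.c true false| := by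
  unfold switchCost
  split_ifs <;> simp

theorem switchCost_nonpos (ρ : G.ShaperPolicy) (ω : ℕ → ShapingStep S A G.A₂) (t : ℕ) :
    G.switchCost ρ ω t ≤ 0 := by
  unfold switchCost
  split_ifs
  exacts [(G.c_neg _ _).le, le_rfl]

/-- The expected discounted sum of the environment rewards. -/
def environmentReturn (π : G.ControllerPolicy) (ρ : G.ShaperPolicy) (z : S × Bool) : ℝ :=
  ∫ ω, ∑' t, G.γ ^ t * G.R (ω t).state (ω t).act ∂playLaw π ρ z

/-- The expected discounted sum of the switching costs. -/
def costReturn (π : G.ControllerPolicy) (ρ : G.ShaperPolicy) (z : S × Bool) : ℝ :=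
  ∫ ω, ∑' t, G.γ ^ t * G.switchCost ρ ω t ∂playLaw π ρ z

/-- The expected discounted sum of Shaper's bonuses. -/
def bonusReturn (π : G.ControllerPolicy) (ρ : G.ShaperPolicy) (z : S × Bool) : ℝ :=
  ∫ ω, ∑' t, G.γ ^ t * G.L (ω t).state (G.visits ω t) ∂playLaw π ρ z

/-- The shaping rewards of a play cancel. -/
theorem controllerReturn_eq (π : G.ControllerPolicy) (ρ : G.ShaperPolicy) (z : S × Bool) :
    G.controllerReturn π ρ z = G.environmentReturn π ρ z := by
  obtain ⟨C, hC⟩ := G.exists_abs_reward_le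
  obtain ⟨D, hD⟩ := G.R_bounded
  obtain ⟨E, hE⟩ := G.φ_bounded
  refine integral_congr_ae ?_
  filter_upwards [ae_playLaw_switch π ρ z, ae_playLaw_forall z (q := fun x =>
    x.shaperAct = G.null ∨ x.switch = true ∧ ρ.flip x.state = false) fun s i x hx => by
      obtain ⟨h₁, h₂, -, h₃⟩ := of_mem_support_stepLaw hx
      rwa [h₁, h₂]] with ω hs hb
  have h₁ := (summable_discounted G.γ_pos.le G.γ_lt_one
    fun t => hC ω t).hasSum.tendsto_sum_nat.comp (tendsto_add_atTop_nat 1)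
  have h₂ := (summable_discounted G.γ_pos.le G.γ_lt_one
    fun t => hD (ω t).state (ω t).act).hasSum.tendsto_sum_nat.comp (tendsto_add_atTop_nat 1)
  -- The boundary term of the telescoping sum vanishes in the limit since `φ` is bounded.
  have h₃ := (summable_discounted G.γ_pos.le G.γ_lt_one
    fun t => hE (ω t).state (ω t).shaperAct).tendsto_atTop_zero
  refine tendsto_nhds_unique h₁ (((h₂.add h₃).congr fun n => ?_).trans (by rw [add_zero]))
  exact (G.shaping_telescopes hs hb n).symm

theorem value_eq (π : G.ControllerPolicy) (ρ : G.ShaperPolicy) (z : S × Bool) :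
    G.value π ρ z = G.environmentReturn π ρ z + G.costReturn π ρ z := by
  obtain ⟨C, hC⟩ := G.exists_abs_reward_le
  rw [← controllerReturn_eq, controllerReturn, costReturn, ← integral_add
    (integrable_discountedSum G.γ_pos.le G.γ_lt_one G.measurable_reward fun t ω => hC ω t)
    (integrable_discountedSum G.γ_pos.le G.γ_lt_one (G.measurable_switchCost ρ)
      fun t ω => G.abs_switchCost_le ρ ω t)]
  refine integral_congr_ae (.of_forall fun ω => ?_)
  simp only [mul_add]
  exact (summable_discounted G.γ_pos.le G.γ_lt_one (hC ω)).tsum_add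
    (summable_discounted G.γ_pos.le G.γ_lt_one (G.abs_switchCost_le ρ ω))

open Classical in
/-- The number of visits to the current state before time `t`, along a path of outcomes. -/
def outcomeVisits (η : ℕ → S × A) (t : ℕ) : ℕ :=
  ((Finset.range t).filter fun j => (η j).1 = (η t).1).card

theorem measurable_bonus [Countable S] [MeasurableSpace S] [MeasurableSpace A]
    [DiscreteMeasurableSpace S] (t : ℕ) :
    Measurable fun η : ℕ → S × A => G.L (η t).1 (outcomeVisits η t) := by
  classical
  have hst : ∀ j, Measurable fun η : ℕ → S × A => (η j).1 := fun j =>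
    measurable_fst.comp (measurable_pi_apply j)
  have hv : Measurable fun η : ℕ → S × A => outcomeVisits η t := by
    simp only [outcomeVisits, Finset.card_filter]
    refine Finset.measurable_sum _ fun j _ => ?_
    exact (Measurable.of_discrete (f := fun x : S × S => if x.1 = x.2 then 1 else 0)).comp
      ((hst j).prodMk (hst t))
  exact (Measurable.of_discrete (f := fun x : S × ℕ => G.L x.1 x.2)).comp ((hst t).prodMk hv)

theorem shaperReturn_eq [Countable S] (π : G.ControllerPolicy) (ρ : G.ShaperPolicy)
    (z : S × Bool) : G.shaperReturn π ρ z = G.value π ρ z + G.bonusReturn π ρ z := by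
  obtain ⟨C, hC⟩ := G.exists_abs_reward_le
  obtain ⟨D, hD⟩ := G.L_bounded
  let _ : MeasurableSpace S := ⊤
  let _ : MeasurableSpace A := ⊤
  have hrc : ∀ ω t, |G.reward ω t + G.switchCost ρ ω t| ≤ C + |G.c true false| := fun ω t =>
    (abs_add_le _ _).trans (add_le_add (hC ω t) (G.abs_switchCost_le ρ ω t))
  have hm : Measurable fun (ω : ℕ → ShapingStep S A G.A₂) t => outcome (ω t) :=
    measurable_pi_lambda _ fun t => measurable_comp_eval outcome t
  have h₁ := integrable_discountedSum (μ := playLaw π ρ z)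
    (F := fun t ω => G.reward ω t + G.switchCost ρ ω t) G.γ_pos.le G.γ_lt_one
    (fun t => (G.measurable_reward t).add (G.measurable_switchCost ρ t)) fun t ω => hrc ω t
  have h₂ := integrable_discountedSum (μ := playLaw π ρ z)
    (F := fun t ω => G.L (ω t).state (G.visits ω t)) G.γ_pos.le G.γ_lt_one
    (fun t => (G.measurable_bonus t).comp hm) fun t ω => hD _ _
  rw [value, bonusReturn, ← integral_add h₁ h₂]
  refine integral_congr_ae (.of_forall fun ω => ?_)
  refine (tsum_congr fun t => mul_add _ _ _).trans ?_
  exact (summable_discounted G.γ_pos.le G.γ_lt_one (hrc ω)).tsum_add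
    (summable_discounted G.γ_pos.le G.γ_lt_one fun t => hD _ _)

theorem environmentReturn_congr [Countable S] [Countable A] (π : G.ControllerPolicy)
    (ρ ρ' : G.ShaperPolicy) (z : S × Bool) :
    G.environmentReturn π ρ z = G.environmentReturn π ρ' z := by
  obtain ⟨D, hD⟩ := G.R_bounded
  let _ : MeasurableSpace S := ⊤
  let _ : MeasurableSpace A := ⊤
  exact integral_outcome_playLaw π ρ ρ' z.1 z.2 z.2
    (F := fun η => ∑' t, G.γ ^ t * G.R (η t).1 (η t).2)
    (measurable_discountedSum G.γ_pos.le G.γ_lt_one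
      (fun t => measurable_comp_eval (fun x : S × A => G.R x.1 x.2) t) fun t η => hD _ _)

/-- The bonus is a function of the state path alone, so it cancels when two Shaper policies are
compared. -/
theorem bonusReturn_congr [Countable S] [Countable A] (π : G.ControllerPolicy)
    (ρ ρ' : G.ShaperPolicy) (z : S × Bool) :
    G.bonusReturn π ρ z = G.bonusReturn π ρ' z := by
  obtain ⟨D, hD⟩ := G.L_bounded
  let _ : MeasurableSpace S := ⊤
  let _ : MeasurableSpace A := ⊤
  exact integral_outcome_playLaw π ρ ρ' z.1 z.2 z.2
    (F := fun η => ∑' t, G.γ ^ t * G.L (η t).1 (outcomeVisits η t))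
    (measurable_discountedSum G.γ_pos.le G.γ_lt_one G.measurable_bonus fun t η => hD _ _)

theorem costReturn_nonpos (π : G.ControllerPolicy) (ρ : G.ShaperPolicy) (z : S × Bool) :
    G.costReturn π ρ z ≤ 0 :=
  integral_nonpos fun ω => tsum_nonpos fun t =>
    mul_nonpos_of_nonneg_of_nonpos (pow_nonneg G.γ_pos.le t) (G.switchCost_nonpos ρ ω t)

theorem costReturn_eq_zero (π : G.ControllerPolicy) {ρ : G.ShaperPolicy}
    (hρ : ∀ s, ρ.flip s = false) (z : S × Bool) : G.costReturn π ρ z = 0 := by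
  simp [costReturn, switchCost, hρ]

/-- The discounted environment reward and the value of the next state, in expectation. -/
theorem integral_reward_add_next {v : S → ℝ} {K : ℝ} (hv : ∀ s, |v s| ≤ K)
    (π : G.ControllerPolicy) (ρ : G.ShaperPolicy) (z : S × Bool) (t : ℕ) :
    ∫ ω, G.R (ω t).state (ω t).act ∂playLaw π ρ z +
        G.γ * ∫ ω, v (ω (t + 1)).state ∂playLaw π ρ z =
      ∫ ω, G.actionValue v (ω t).state (ω t).act ∂playLaw π ρ z := by
  obtain ⟨C, hC⟩ := G.R_bounded
  have hnext : ∫ ω, v (ω (t + 1)).state ∂playLaw π ρ z =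
      ∫ ω, ∑' s', (G.P (ω t).state (ω t).act s').toReal * v s' ∂playLaw π ρ z := by
    refine (integral_trajMeasure_succ (κ := historyKernel π ρ) (p₀ := stepLaw π ρ z.1 z.2)
      (K := nextLaw π ρ) (g := fun x => v x.state)
      (fun _ _ => rfl) (fun x => hv x.state) t).trans ?_
    exact integral_congr_ae (.of_forall fun ω =>
      PMF.integral_toMeasure_eq_tsum_of_map_eq (map_state_nextLaw π ρ (ω t)) hv)
  rw [hnext, ← integral_const_mul, ← integral_add]
  · rfl
  · exact Integrable.of_bound (measurable_comp_eval (fun x : ShapingStep S A G.A₂ => G.R x.state x.act)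
      t).aestronglyMeasurable C (.of_forall fun ω => hC _ _)
  · exact (Integrable.of_bound (measurable_comp_eval
      (fun x : ShapingStep S A G.A₂ => ∑' s', (G.P x.state x.act s').toReal * v s')
      t).aestronglyMeasurable K
      (.of_forall fun ω => PMF.abs_tsum_toReal_mul_le _ hv)).const_mul _

/-! ### Verification for the optimality equation, and the stable points -/

/-- The discounted Bellman residuals of `v` telescope along a play, up to `γ ^ n` times a bounded
term. The sign of the residuals then compares the environment return with `v`: nonpositive residuals
bound it, zero residuals along the policy give equality. -/
theorem tendsto_discounted_integral {v : S → ℝ} {K : ℝ} (hv : ∀ s, |v s| ≤ K)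
    (π : G.ControllerPolicy) (ρ : G.ShaperPolicy) (z : S × Bool) :
    Tendsto (fun n : ℕ => ∑ t ∈ Finset.range n, G.γ ^ t *
        ∫ ω, G.actionValue v (ω t).state (ω t).act - v (ω t).state ∂playLaw π ρ z) atTop
      (𝓝 (G.environmentReturn π ρ z - v z.1)) := by
  obtain ⟨C, hC⟩ := G.R_bounded
  have hiv : ∀ t, Integrable (fun ω => v (ω t).state) (playLaw π ρ z) := fun t =>
    Integrable.of_bound (measurable_comp_eval (fun x : ShapingStep S A G.A₂ => v x.state)
      t).aestronglyMeasurable K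
      (.of_forall fun ω => hv _)
  have hQ : ∀ s a, |G.actionValue v s a| ≤ C + G.γ * K := fun s a => by
    refine (abs_add_le _ _).trans (add_le_add (hC s a) ?_)
    rw [abs_mul, abs_of_pos G.γ_pos]
    exact mul_le_mul_of_nonneg_left ((G.P s a).abs_tsum_toReal_mul_le hv) G.γ_pos.le
  have hiQ : ∀ t, Integrable (fun ω => G.actionValue v (ω t).state (ω t).act)
      (playLaw π ρ z) := fun t =>
    Integrable.of_bound (measurable_comp_eval
      (fun x : ShapingStep S A G.A₂ => G.actionValue v x.state x.act) t).aestronglyMeasurable _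
      (.of_forall fun ω => hQ _ _)
  have h₀ : ∫ ω, v (ω 0).state ∂playLaw π ρ z = v z.1 := by
    have : (fun ω : ℕ → ShapingStep S A G.A₂ => v (ω 0).state) =ᵐ[playLaw π ρ z]
        fun _ => v z.1 := by
      filter_upwards [ae_playLaw_zero π ρ z] with ω hω
      rw [hω.1]
    rw [integral_congr_ae this]
    simp
  have hsum := (hasSum_integral_discounted (μ := playLaw π ρ z)
    (F := fun t ω => G.R (ω t).state (ω t).act) G.γ_pos.le G.γ_lt_one
    (fun t => measurable_comp_eval (fun x : ShapingStep S A G.A₂ => G.R x.state x.act) t)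
    fun t ω => hC _ _).tendsto_sum_nat
  have hlast : Tendsto (fun n : ℕ => G.γ ^ n * ∫ ω, v (ω n).state ∂playLaw π ρ z) atTop (𝓝 0) :=
    (hasSum_integral_discounted (μ := playLaw π ρ z) (F := fun t ω => v (ω t).state) G.γ_pos.le
      G.γ_lt_one (fun t => measurable_comp_eval (fun x : ShapingStep S A G.A₂ => v x.state) t)
      fun t ω => hv _).summable.tendsto_atTop_zero
  have key : ∀ n : ℕ, ∑ t ∈ Finset.range n, G.γ ^ t *
        ∫ ω, G.actionValue v (ω t).state (ω t).act - v (ω t).state ∂playLaw π ρ z =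
      ∑ t ∈ Finset.range n, G.γ ^ t * ∫ ω, G.R (ω t).state (ω t).act ∂playLaw π ρ z +
        G.γ ^ n * ∫ ω, v (ω n).state ∂playLaw π ρ z - v z.1 := by
    intro n
    induction n with
    | zero => simp [h₀]
    | succ n ih =>
      rw [Finset.sum_range_succ, ih, Finset.sum_range_succ, integral_sub (hiQ n) (hiv n),
        ← G.integral_reward_add_next hv]
      ring
  have := (hsum.add hlast).sub_const (v z.1)
  rw [add_zero] at this
  exact this.congr fun n => (key n).symm

theorem environmentReturn_le {v : S → ℝ} (hv : ∃ K, ∀ s, |v s| ≤ K)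
    (h : ∀ s a, G.actionValue v s a ≤ v s) (π : G.ControllerPolicy) (ρ : G.ShaperPolicy)
    (z : S × Bool) : G.environmentReturn π ρ z ≤ v z.1 := by
  obtain ⟨K, hK⟩ := hv
  refine sub_nonpos.1 (le_of_tendsto' (G.tendsto_discounted_integral hK π ρ z) fun n => ?_)
  exact Finset.sum_nonpos fun t _ => mul_nonpos_of_nonneg_of_nonpos (pow_nonneg G.γ_pos.le t)
    (integral_nonpos fun ω => sub_nonpos.2 (h _ _))

theorem environmentReturn_eq {v : S → ℝ} (hv : ∃ K, ∀ s, |v s| ≤ K) {π : G.ControllerPolicy}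
    (h : ∀ s, ∀ a ∈ (π s).support, G.actionValue v s a = v s) (ρ : G.ShaperPolicy)
    (z : S × Bool) : G.environmentReturn π ρ z = v z.1 := by
  obtain ⟨K, hK⟩ := hv
  refine sub_eq_zero.1 (tendsto_nhds_unique (G.tendsto_discounted_integral hK π ρ z)
    (tendsto_const_nhds.congr fun n => (Finset.sum_eq_zero fun t _ => ?_).symm))
  have hae := ae_playLaw_forall (π := π) (ρ := ρ) z
    (q := fun x => G.actionValue v x.state x.act = v x.state) fun s i x hx => by
      obtain ⟨h₁, -, h₃, -⟩ := of_mem_support_stepLaw hx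
      rw [h₁]
      exact h s _ h₃
  rw [integral_eq_zero_of_ae, mul_zero]
  filter_upwards [hae] with ω hω
  exact sub_eq_zero.2 (hω t)

/-- Some Controller policy attains, from every state, the largest expected discounted sum of
environment rewards. -/
theorem exists_optimal_policy [Finite A] [Nonempty A] {v : S → ℝ} (hv : ∃ K, ∀ s, |v s| ≤ K)
    (h : ∀ s, ⨆ a, G.actionValue v s a = v s) :
    ∃ π : G.ControllerPolicy, ∀ ρ z, G.environmentReturn π ρ z = v z.1 := by
  choose f hf using fun s => exists_eq_ciSup_of_finite (f := G.actionValue v s)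
  refine ⟨fun s => PMF.pure (f s), G.environmentReturn_eq hv fun s a ha => ?_⟩
  rw [(PMF.mem_support_pure_iff _ _).1 ha, hf, h]

/-- The Shaper policy that never switches. -/
def neverSwitch : G.ShaperPolicy := ⟨fun _ => false, fun _ => PMF.pure G.null⟩

theorem value_le {v : S → ℝ} (hv : ∃ K, ∀ s, |v s| ≤ K)
    (h : ∀ s a, G.actionValue v s a ≤ v s) (π : G.ControllerPolicy) (ρ : G.ShaperPolicy)
    (z : S × Bool) : G.value π ρ z ≤ v z.1 := by
  rw [value_eq]
  linarith [G.environmentReturn_le hv h π ρ z, G.costReturn_nonpos π ρ z]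

theorem isStable_iff [Countable S] [Finite A] [Nonempty A] {v : S → ℝ}
    (hv : ∃ K, ∀ s, |v s| ≤ K) (h : ∀ s, ⨆ a, G.actionValue v s a = v s)
    (π : G.ControllerPolicy) (ρ : G.ShaperPolicy) :
    G.IsStable π ρ ↔ ∀ z, G.value π ρ z = v z.1 := by
  have hle : ∀ s a, G.actionValue v s a ≤ v s := fun s a =>
    h s ▸ le_ciSup (Set.finite_range (G.actionValue v s)).bddAbove a
  constructor
  · rintro ⟨h₁, h₂⟩ z
    -- Controller's deviation to an optimal policy shows that the environment return is at least
    -- `v`; Shaper's deviation to `neverSwitch` shows that the value is at least the environment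
    -- return.
    obtain ⟨π', hπ'⟩ := G.exists_optimal_policy hv h
    have hπ := h₁ π' z
    rw [controllerReturn_eq, controllerReturn_eq, hπ'] at hπ
    have hρ := h₂ G.neverSwitch z
    rw [shaperReturn_eq, shaperReturn_eq, G.bonusReturn_congr π _ ρ, add_le_add_iff_right, value_eq,
      G.costReturn_eq_zero π (ρ := G.neverSwitch) fun _ => rfl, add_zero,
      G.environmentReturn_congr π _ ρ] at hρ
    exact (G.value_le hv hle π ρ z).antisymm (hπ.trans hρ)
  · intro heq
    -- As the cost is nonpositive, value `v` forces environment return at least `v`, so Controller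
    -- cannot gain; Shaper cannot gain because no value exceeds `v`.
    refine ⟨fun π' z => ?_, fun ρ' z => ?_⟩
    · have := heq z
      rw [value_eq] at this
      rw [controllerReturn_eq, controllerReturn_eq]
      linarith [G.environmentReturn_le hv hle π' ρ z, G.costReturn_nonpos π ρ z]
    · rw [shaperReturn_eq, shaperReturn_eq, G.bonusReturn_congr π ρ' ρ, add_le_add_iff_right, heq]
      exact G.value_le hv hle π ρ' z

end ShapingGame

end

theorem mainTheorem3 {S A : Type*} [Countable S] [Fintype A] [Nonempty A] {p : ℕ}
    (G : ShapingGame S A p) :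
    -- every Bellman operator of the game is a `γ`-contraction for the sup norm
    (∀ (π : G.ControllerPolicy) (V W : S × Bool → ℝ) (C : ℝ),
      (∃ K, ∀ z, |V z| ≤ K) → (∃ K, ∀ z, |W z| ≤ K) → (∀ z, |V z - W z| ≤ C) →
        ∀ z, |G.bellman π V z - G.bellman π W z| ≤ G.γ * C) ∧
    -- there is a stable point; its value is the largest value of a policy profile and the limit of
    -- the iterates of each Bellman operator; and the stable points are the profiles of that value
    ∃ (πs : G.ControllerPolicy) (ρs : G.ShaperPolicy),
      G.IsStable πs ρs ∧
      (∀ z, IsGreatest {x | ∃ (π : G.ControllerPolicy) (ρ : G.ShaperPolicy), G.value π ρ z = x}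
        (G.value πs ρs z)) ∧
      (∀ (π : G.ControllerPolicy) (V : S × Bool → ℝ), (∃ K, ∀ z, |V z| ≤ K) →
        TendstoUniformly (fun k : ℕ => (G.bellman π)^[k] V) (G.value πs ρs) atTop) ∧
      (∀ (π : G.ControllerPolicy) (ρ : G.ShaperPolicy),
        G.IsStable π ρ ↔ ∀ z, G.value π ρ z = G.value πs ρs z) := by
  obtain ⟨v, hv, h⟩ := G.exists_optimalValue
  obtain ⟨πs, hπs⟩ := G.exists_optimal_policy hv h
  have hle : ∀ s a, G.actionValue v s a ≤ v s := fun s a =>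
    h s ▸ le_ciSup (Set.finite_range (G.actionValue v s)).bddAbove a
  have hval : ∀ z, G.value πs G.neverSwitch z = v z.1 := fun z => by
    rw [G.value_eq, G.costReturn_eq_zero πs fun _ => rfl, add_zero, hπs]
  refine ⟨G.abs_bellman_sub_le, πs, G.neverSwitch, (G.isStable_iff hv h _ _).2 hval,
    fun z => ⟨⟨πs, G.neverSwitch, rfl⟩, ?_⟩, fun π V hV => ?_, fun π ρ => ?_⟩
  · rintro _ ⟨π, ρ, rfl⟩
    rw [hval]
    exact G.value_le hv hle π ρ z
  · obtain ⟨K, hK⟩ := hv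
    -- The value `v` does not involve `π`, so the operators for all `π` share this limit.
    rw [funext hval]
    exact tendstoUniformly_iterate_of_contracting G.γ_pos.le G.γ_lt_one (G.abs_bellman_sub_le π)
      ⟨K, fun z => hK z.1⟩ (G.bellman_optimalValue h π) hV
  · simp only [G.isStable_iff hv h, hval]
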